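/- A plane map is a finite connected graph (loops and multiple edges allowed) embedded in the plane without edge crossings; an arc is an edge with a choice of direction. A 5-triangulation $G$ is a plane map whose outer face contour is a simple cycle of length 5, with vertices $v_1,\dots,v_5$ in clockwise order, and whose other faces all have degree 3. Vertices, edges and arcs are outer if they are incident to the outer face, and inner otherwise; indices are taken modulo 5. A 5c-wood of $G$ is a tuple $(W_1,\dots,W_5)$ of disjoint sets of inner arcs ("colors") such that: (W0) no arc of any $W_i$ starts at an outer vertex, and those ending at $v_i$ have color $i$; (W1) every inner vertex has exactly one outgoing arc of each color $1,\dots,5$, and these arcs appear in clockwise order around it; (W2) if $v$ is an inner vertex with outgoing arcs $a_1,\dots,a_5$ of colors $1,\dots,5$, then any arc of color $i$ with terminal vertex $v$ appears weakly between $a_{i+2}$ and $a_{i+3}$ in clockwise order around $v$ (it may be the arc opposite to $a_{i+2}$ or $a_{i+3}$); (W3) every inner edge has at least one color. For a set $A$ of arcs, $A^-$ denotes the set of the opposite arcs; $A$ is acyclic if it contains no simple directed cycle, where two opposite arcs of the same edge do not count as a simple cycle. Proposition. Let $(W_1,\dots,W_5)$ be a 5c-wood of a 5-triangulation $G$. Then: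 (1) for every $i$, the set of arcs $W_i\cup W_{i-1}\cup W_{i+1}\cup W_{i-2}^-\cup W_{i+2}^-$ is acyclic; (2) for all $j,k$ (including $j=k$), the set of arcs $W_j\cup W_k^-$ is acyclic; (3) for every $i$, $W_i$ is a tree spanning exactly the inner vertices and $v_i$, directed toward the root $v_i$; (4) for every inner vertex $v$ there is, for each $i$, a unique directed path $P_i(v)$ from $v$ to $v_i$ in $W_i$, and for $i\ne j$ the paths $P_i(v)$ and $P_j(v)$ have no vertex in common except $v$. -/

import Mathlib

/-- A plane map, i.e. a finite connected graph (loops and multiple edges allowed) embedded in the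
plane without crossings, encoded by its rotation system. `D` is the set of arcs (edges with a choice
of direction), `opp` sends an arc to the opposite arc, and `rot` sends an arc `a` to the arc that
follows `a` in clockwise order among the arcs with the same initial vertex. Vertices are the orbits
of `rot`, edges the orbits of `opp`, and faces the orbits of `rot * opp`. A connected rotation system
is an embedding in the sphere exactly when Euler's relation holds. -/
structure PlaneMap (D : Type*) [Finite D] where
  opp : Equiv.Perm D
  rot : Equiv.Perm D
  opp_opp : ∀ a, opp (opp a) = a
  opp_ne : ∀ a, opp a ≠ a
  connected : ∀ a b : D, ∃ g ∈ Subgroup.closure {opp, rot}, g a = b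
  euler : Nat.card (Quotient (Equiv.Perm.SameCycle.setoid rot))
      + Nat.card (Quotient (Equiv.Perm.SameCycle.setoid (rot * opp)))
      = Nat.card (Quotient (Equiv.Perm.SameCycle.setoid opp)) + 2

namespace PlaneMap

variable {D : Type*} [Finite D]

/-- The vertices of the map. -/
def Vertex (M : PlaneMap D) : Type _ := Quotient (Equiv.Perm.SameCycle.setoid M.rot)

/-- The initial vertex of an arc. -/
def src (M : PlaneMap D) (a : D) : M.Vertex := Quotient.mk (Equiv.Perm.SameCycle.setoid M.rot) a

/-- The terminal vertex of an arc. -/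
def tgt (M : PlaneMap D) (a : D) : M.Vertex := M.src (M.opp a)

/-- The arc that follows `a` on the contour of the face on the left of `a`: upon reaching the
terminal vertex of `a`, one takes the arc that comes next to `opp a` in clockwise order. -/
def faceNext (M : PlaneMap D) : Equiv.Perm D := M.rot * M.opp

/-- The arcs that are met when turning clockwise around a vertex from the arc `a` up to the first
visit of the arc `b`, both `a` and `b` included. -/
def cwInterval (M : PlaneMap D) (a b : D) : Set D :=
  {x | ∃ m n : ℕ, m ≤ n ∧ (M.rot ^ m) a = x ∧ (M.rot ^ n) a = b ∧ ∀ k < n, (M.rot ^ k) a ≠ b}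

/-- The arcs opposite to those of `A`. -/
def reverse (M : PlaneMap D) (A : Set D) : Set D := {a | M.opp a ∈ A}

/-- The arcs `c 0, …, c n` form, in this order, a simple directed cycle (of length `n + 1`; the
addition in `Fin (n + 1)` is cyclic). Two opposite arcs do not constitute a simple cycle. -/
structure IsSimpleDirectedCycle (M : PlaneMap D) {n : ℕ} (c : Fin (n + 1) → D) : Prop where
  chain : ∀ k, M.tgt (c k) = M.src (c (k + 1))
  simple : Function.Injective fun k => M.src (c k)
  not_opp : ∀ k, c (k + 1) ≠ M.opp (c k)

/-- A biorientation (set of arcs) is acyclic if it contains no simple directed cycle. -/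
def IsAcyclic (M : PlaneMap D) (A : Set D) : Prop :=
  ∀ (n : ℕ) (c : Fin (n + 1) → D), (∀ k, c k ∈ A) → ¬ M.IsSimpleDirectedCycle c

/-- The list of arcs `p` is a directed walk from `u` to `w` using only arcs of `A`. -/
def IsDirectedWalk (M : PlaneMap D) (A : Set D) : M.Vertex → M.Vertex → List D → Prop
  | u, w, [] => u = w
  | u, w, a :: p => a ∈ A ∧ M.src a = u ∧ M.IsDirectedWalk A (M.tgt a) w p

/-- The list of vertices visited by a directed walk `p` starting at `u`. -/
def support (M : PlaneMap D) (u : M.Vertex) (p : List D) : List M.Vertex := u :: p.map M.tgt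

/-- A directed path is a directed walk that visits no vertex twice. -/
def IsDirectedPath (M : PlaneMap D) (A : Set D) (u w : M.Vertex) (p : List D) : Prop :=
  M.IsDirectedWalk A u w p ∧ (M.support u p).Nodup

/-- The set of arcs `A` is a tree with vertex set `S`, directed toward the root `r ∈ S`: there is no
cycle in the underlying undirected graph, and from each vertex of `S` there is a directed walk to
`r`, which is unique (so every arc goes from child to parent). -/
structure IsTreeToward (M : PlaneMap D) (A : Set D) (S : Set M.Vertex) (r : M.Vertex) : Prop where
  root_mem : r ∈ S
  ends_mem : ∀ a ∈ A, M.src a ∈ S ∧ M.tgt a ∈ S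
  acyclic : M.IsAcyclic (A ∪ M.reverse A)
  walk_to_root : ∀ u ∈ S, ∃! p : List D, M.IsDirectedWalk A u r p

end PlaneMap

/-- A triangulation of the pentagon: a plane map whose outer face contour is a simple cycle of
length 5 and whose other faces have degree 3. `outer i` is the arc from the outer vertex `v_i` to
`v_{i+1}` that has the outer face on its left, so that `v_1, …, v_5` appear in clockwise order.
Indices are integers modulo 5. -/
structure FiveTriangulation (D : Type*) [Finite D] extends PlaneMap D where
  outer : ZMod 5 → D
  outer_next : ∀ i, toPlaneMap.faceNext (outer i) = outer (i + 1)
  outer_simple : Function.Injective fun i => toPlaneMap.src (outer i)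
  inner_face : ∀ a, a ∉ Set.range outer → Function.minimalPeriod toPlaneMap.faceNext a = 3

namespace FiveTriangulation

variable {D : Type*} [Finite D]

/-- The outer vertices `v_i`. -/
def v (T : FiveTriangulation D) (i : ZMod 5) : T.Vertex := T.src (T.outer i)

/-- The vertices that are not incident to the outer face. -/
def innerVertices (T : FiveTriangulation D) : Set T.Vertex := {u | ∀ i, u ≠ T.v i}

/-- The arcs whose edge is not incident to the outer face. -/
def innerArcs (T : FiveTriangulation D) : Set D :=
  {a | ∀ i, a ≠ T.outer i ∧ T.opp a ≠ T.outer i}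

/-- The tuple `(W_1, …, W_5)` of sets of arcs is a 5c-wood. -/
structure IsFiveCWood (T : FiveTriangulation D) (W : ZMod 5 → Set D) : Prop where
  inner : ∀ i, W i ⊆ T.innerArcs
  disjoint : ∀ i j, i ≠ j → Disjoint (W i) (W j)
  /-- No arc of the wood starts at an outer vertex. -/
  outer_src : ∀ i, ∀ a ∈ W i, ∀ j, T.src a ≠ T.v j
  /-- The arcs of the wood that end at `v_j` have color `j`. -/
  outer_tgt : ∀ i, ∀ a ∈ W i, ∀ j, T.tgt a = T.v j → i = j
  /-- Each inner vertex has exactly one outgoing arc of each color. -/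
  out_unique : ∀ u ∈ T.innerVertices, ∀ i, ∃! a, a ∈ W i ∧ T.src a = u
  /-- The outgoing arcs of colors `1, …, 5` appear in clockwise order: among them, the one that
  comes next after that of color `i` is that of color `i + 1`. -/
  out_clockwise : ∀ i j, ∀ a ∈ W i, ∀ b ∈ W (i + 1), ∀ x ∈ W j,
    T.src a = T.src b → T.src x = T.src a → x ∈ T.cwInterval a b → x = a ∨ x = b
  /-- An arc `a` of color `i` ending at an inner vertex appears weakly between the outgoing arcs of
  colors `i + 2` and `i + 3` in clockwise order (the position of `a` around its terminal vertex is
  that of `opp a`). -/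
  in_between : ∀ i, ∀ a ∈ W i, ∀ b ∈ W (i + 2), ∀ c ∈ W (i + 3),
    T.src b = T.tgt a → T.src c = T.tgt a → T.opp a ∈ T.cwInterval b c
  /-- Each inner edge has at least one color. -/
  colored : ∀ a ∈ T.innerArcs, ∃ i, a ∈ W i ∨ T.opp a ∈ W i

end FiveTriangulation

/-!
The map being given by its rotation system, the plane enters only through Euler's relation. It
implies that every cycle of edges is, modulo 2, the boundary of a set of faces
(`PlaneMap.ker_edgeBoundary_le`). Hence a simple directed cycle separates the faces into two sides,
of which one avoids the outer face and is called its interior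
(`PlaneMap.IsSimpleDirectedCycle.exists_faceClosed`). A parity argument around the vertices of the
cycle shows that both sides are connected, so that a cycle running in the closed interior of another
one has a smaller interior (`PlaneMap.IsSimpleDirectedCycle.subset_of_cycle_in_region`).

For a color `i`, call forward the arcs of colors `i - 1`, `i`, `i + 1` and the opposites of those of
colors `i - 2`, `i + 2`. Around an inner vertex with outgoing arcs `a_1, …, a_5`, the forward arcs
that leave the vertex lie between `a_{i-1}` and `a_{i+1}`, and those that arrive there lie between
`a_{i+1}` and `a_{i-1}`. Consequently, at every vertex of a cycle of forward arcs, `a_{i+1}` is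
weakly on the right of the cycle and `a_{i-1}` weakly on its left. If the interior is on the right,
a walk of color `i + 1` that starts on the cycle thus stays in the closed interior for ever, where
all vertices are inner, and produces a cycle of color `i + 1` there; if the interior is on the left,
the same holds with color `i - 1` (`IsFiveCWood.exists_monochromatic_cycle`). Applied to a cycle of
the single color `i`, this gives one with a strictly smaller interior, since an edge cannot have
color `i` and color `i ± 1`, be it in the same direction or in opposite directions
(`IsFiveCWood.eq_of_opp_mem`). By infinite descent there are no monochromatic cycles, hence no
cycles of forward arcs.

The other claims follow. For `j ≠ k`, the arcs of color `j` and the opposites of those of color `k`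
are forward for a common `i`; for `j = k`, a simple cycle cannot change its direction relative to
color `j`, as there is only one outgoing arc of that color at each vertex. Following the arcs of
color `i` from an inner vertex, one meets no cycle and can only stop at `v_i`. Finally, if the paths
of colors `i ≠ j` from `u` met again at `w`, going to `w` on the first and returning to `u` on the
second would give a cycle in `W i ∪ T.reverse (W j)` (`PlaneMap.not_isAcyclic_of_reflTransGen`).
-/

/-! ### Regions bounded by simple cycles -/

namespace PlaneMap

variable {D : Type*} [Finite D]

/-- A union of faces, as a set of arcs: `S` contains an arc when it contains the face on the left of
that arc. The face on the left of `M.opp a` is also the one on the left of `M.rot a`. -/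
def FaceClosed (M : PlaneMap D) (S : Set D) : Prop := ∀ a, M.opp a ∈ S ↔ M.rot a ∈ S

/-- The arcs that have `S` on exactly one of their two sides. -/
def frontier (M : PlaneMap D) (S : Set D) : Set D := {a | ¬ (a ∈ S ↔ M.opp a ∈ S)}

theorem src_eq_src_iff (M : PlaneMap D) {a b : D} :
    M.src a = M.src b ↔ M.rot.SameCycle a b := Quotient.eq

theorem src_rot (M : PlaneMap D) (a : D) : M.src (M.rot a) = M.src a :=
  M.src_eq_src_iff.2 (Equiv.Perm.SameCycle.refl _ _).apply_left

theorem src_rot_pow (M : PlaneMap D) (n : ℕ) (a : D) : M.src ((M.rot ^ n) a) = M.src a := by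
  induction n with
  | zero => rfl
  | succ n ih => rw [pow_succ', Equiv.Perm.mul_apply, src_rot, ih]

theorem tgt_opp (M : PlaneMap D) (a : D) : M.tgt (M.opp a) = M.src a := by
  rw [tgt, M.opp_opp]

theorem edge_eq_edge_iff (M : PlaneMap D) {a b : D} :
    M.opp.SameCycle a b ↔ a = b ∨ M.opp a = b := by
  constructor
  · rintro ⟨n, rfl⟩
    have hsq : M.opp ^ (2 : ℤ) = 1 := by
      ext x
      simp [zpow_ofNat, pow_two, M.opp_opp]
    rcases Int.even_or_odd' n with ⟨m, rfl | rfl⟩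
    · left; rw [zpow_mul, hsq]; simp
    · right; rw [zpow_add, zpow_mul, hsq]; simp
  · rintro (rfl | rfl)
    · exact Equiv.Perm.SameCycle.refl _ _
    · exact (Equiv.Perm.SameCycle.refl _ _).apply_right

/-- A function on arcs that is constant on edges and on vertices is constant, as the map is
connected. -/
theorem eq_of_invariant (M : PlaneMap D) {α : Type*} (f : D → α) (hopp : ∀ a, f (M.opp a) = f a)
    (hrot : ∀ a, f (M.rot a) = f a) (a b : D) : f a = f b := by
  obtain ⟨g, hg, rfl⟩ := M.connected a b
  have key : ∀ x, f (g x) = f x := by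
    induction hg using Subgroup.closure_induction with
    | mem x hx =>
      rcases hx with rfl | rfl
      · exact hopp
      · exact hrot
    | one => intro x; rfl
    | mul x y _ _ hx hy => intro z; rw [Equiv.Perm.mul_apply, hx, hy]
    | inv x _ hx => intro z; rw [← hx (x⁻¹ z)]; exact congrArg f (x.apply_symm_apply z)
  exact (key a).symm

/-- A union of faces with empty frontier is empty or everything. -/
theorem FaceClosed.mem_iff_mem {M : PlaneMap D} {S : Set D} (hS : M.FaceClosed S)
    (h : ∀ a, a ∉ M.frontier S) (a b : D) : a ∈ S ↔ b ∈ S := by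
  have hopp : ∀ a, a ∈ S ↔ M.opp a ∈ S := fun a => not_not.1 (h a)
  exact iff_of_eq <| M.eq_of_invariant (· ∈ S) (fun x => propext (hopp x).symm)
    (fun x => propext ((hS x).symm.trans (hopp x).symm)) a b

section Homology

/-- The edges of the map. -/
abbrev Edge (M : PlaneMap D) : Type _ := Quotient (Equiv.Perm.SameCycle.setoid M.opp)

/-- The faces of the map. -/
abbrev Face (M : PlaneMap D) : Type _ := Quotient (Equiv.Perm.SameCycle.setoid (M.rot * M.opp))

/-- The edge of an arc. -/
def edge (M : PlaneMap D) (a : D) : M.Edge := Quotient.mk (Equiv.Perm.SameCycle.setoid M.opp) a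

/-- The face on the left of an arc. -/
def face (M : PlaneMap D) (a : D) : M.Face :=
  Quotient.mk (Equiv.Perm.SameCycle.setoid (M.rot * M.opp)) a

instance (M : PlaneMap D) : Finite M.Vertex :=
  inferInstanceAs (Finite (Quotient (Equiv.Perm.SameCycle.setoid M.rot)))

theorem edge_eq_iff (M : PlaneMap D) {a b : D} : M.edge a = M.edge b ↔ a = b ∨ M.opp a = b :=
  Quotient.eq.trans M.edge_eq_edge_iff

theorem face_rot (M : PlaneMap D) (a : D) : M.face (M.rot a) = M.face (M.opp a) := by
  refine Quotient.sound ?_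
  have h : M.rot a = (M.rot * M.opp) (M.opp a) := by
    rw [Equiv.Perm.mul_apply, M.opp_opp]
  rw [h]
  exact (Equiv.Perm.SameCycle.refl _ _).apply_left

/-- The boundary, modulo 2, of a set of faces: the edges with exactly one side in the set. -/
noncomputable def faceBoundary (M : PlaneMap D) :
    (M.Face → ZMod 2) →ₗ[ZMod 2] (M.Edge → ZMod 2) where
  toFun φ e := φ (M.face e.out) + φ (M.face (M.opp e.out))
  map_add' φ ψ := by ext e; simp only [Pi.add_apply]; ring
  map_smul' r φ := by ext e; simp only [Pi.smul_apply, smul_eq_mul, RingHom.id_apply]; ring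

theorem faceBoundary_apply (M : PlaneMap D) (φ : M.Face → ZMod 2) (a : D) :
    M.faceBoundary φ (M.edge a) = φ (M.face a) + φ (M.face (M.opp a)) := by
  have h : M.edge (M.edge a).out = M.edge a := Quotient.out_eq _
  change φ (M.face (M.edge a).out) + φ (M.face (M.opp (M.edge a).out)) = _
  rcases M.edge_eq_iff.1 h with h | h
  · rw [h]
  · rw [h, ← M.opp_opp (M.edge a).out, h, add_comm]

open Classical in
/-- The boundary, modulo 2, of a set of edges: the vertices where an odd number of arcs of the set
start. -/
noncomputable def edgeBoundary (M : PlaneMap D) [Fintype D] :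
    (M.Edge → ZMod 2) →ₗ[ZMod 2] (M.Vertex → ZMod 2) where
  toFun f u := ∑ a : D, if M.src a = u then f (M.edge a) else 0
  map_add' f g := by
    ext u
    simp only [Pi.add_apply, ← Finset.sum_add_distrib]
    exact Finset.sum_congr rfl fun a _ => by split_ifs <;> simp
  map_smul' r f := by
    ext u
    simp only [Pi.smul_apply, smul_eq_mul, RingHom.id_apply, Finset.mul_sum, mul_ite, mul_zero]

open Classical in
theorem edgeBoundary_single (M : PlaneMap D) [Fintype D] (a : D) :
    M.edgeBoundary (Pi.single (M.edge a) 1) =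
      Pi.single (M.src a) 1 + Pi.single (M.tgt a) 1 := by
  ext u
  have h : ∀ x : D, (if M.src x = u then (Pi.single (M.edge a) 1 : M.Edge → ZMod 2) (M.edge x)
      else 0) = if x ∈ ({a, M.opp a} : Finset D) then (if M.src x = u then 1 else 0) else 0 := by
    intro x
    have hx : x ∈ ({a, M.opp a} : Finset D) ↔ M.edge x = M.edge a := by
      rw [eq_comm, M.edge_eq_iff, Finset.mem_insert, Finset.mem_singleton, eq_comm, @eq_comm _ x]
    simp only [hx, Pi.single_apply]
    split_ifs <;> rfl
  change (∑ x : D, if M.src x = u then (Pi.single (M.edge a) 1 : M.Edge → ZMod 2) (M.edge x)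
      else 0) = _
  rw [Finset.sum_congr rfl fun x _ => h x, Finset.sum_ite_mem, Finset.univ_inter,
    Finset.sum_pair (M.opp_ne a).symm]
  simp only [Pi.add_apply, Pi.single_apply, tgt, eq_comm]

theorem edgeBoundary_faceBoundary (M : PlaneMap D) [Fintype D] (φ : M.Face → ZMod 2) :
    M.edgeBoundary (M.faceBoundary φ) = 0 := by
  classical
  ext u
  change (∑ a : D, if M.src a = u then M.faceBoundary φ (M.edge a) else 0) = 0
  have h : ∀ a, (if M.src a = u then M.faceBoundary φ (M.edge a) else 0) =
      (if M.src a = u then φ (M.face a) else 0) +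
        (if M.src (M.rot a) = u then φ (M.face (M.rot a)) else 0) := by
    intro a
    rw [M.faceBoundary_apply, M.src_rot, M.face_rot]
    split_ifs <;> simp
  rw [Finset.sum_congr rfl fun a _ => h a, Finset.sum_add_distrib,
    Equiv.sum_comp M.rot (fun a => if M.src a = u then φ (M.face a) else 0)]
  exact CharTwo.add_self_eq_zero _

/-- The first homology of the sphere vanishes modulo 2, which is Euler's relation in terms of
dimensions: `faceBoundary` has kernel of dimension at most 1, as a union of faces without boundary
is trivial, and the range of `edgeBoundary` has codimension at most 1, as it contains the sum of any
two vertices. -/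
theorem ker_edgeBoundary_le (M : PlaneMap D) [Fintype D] :
    LinearMap.ker M.edgeBoundary ≤ LinearMap.range M.faceBoundary := by
  classical
  cases isEmpty_or_nonempty D with
  | inl h =>
    intro f _
    refine ⟨0, funext fun e => ?_⟩
    exact h.elim e.out
  | inr h =>
  obtain ⟨a₀⟩ := h
  have := Fintype.ofFinite M.Vertex
  have := Fintype.ofFinite M.Edge
  have := Fintype.ofFinite M.Face
  have hker : Module.finrank (ZMod 2) (LinearMap.ker M.faceBoundary) ≤ 1 := by
    have hone : (fun _ => 1 : M.Face → ZMod 2) ∈ LinearMap.ker M.faceBoundary := by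
      rw [LinearMap.mem_ker]
      ext e
      exact CharTwo.add_self_eq_zero _
    refine finrank_le_one ⟨_, hone⟩ fun φ => ⟨φ.1 (M.face a₀), Subtype.ext (funext fun x => ?_)⟩
    have hopp : ∀ a, φ.1 (M.face (M.opp a)) = φ.1 (M.face a) := by
      intro a
      have h := congrFun (LinearMap.mem_ker.1 φ.2) (M.edge a)
      rw [M.faceBoundary_apply] at h
      exact (CharTwo.add_eq_zero.1 h).symm
    induction x using Quotient.inductionOn with
    | h a =>
      change φ.1 (M.face a₀) * 1 = φ.1 (M.face a)
      rw [mul_one]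
      exact M.eq_of_invariant (fun x => φ.1 (M.face x)) hopp
        (fun x => by simp only [M.face_rot, hopp]) a₀ a
  have hrange : Fintype.card M.Vertex ≤
      Module.finrank (ZMod 2) (LinearMap.range M.edgeBoundary) + 1 := by
    have hpair : ∀ a b, (Pi.single (M.src a) 1 + Pi.single (M.src b) 1 : M.Vertex → ZMod 2) ∈
        LinearMap.range M.edgeBoundary := by
      intro a b
      have := M.eq_of_invariant (fun x => (Submodule.Quotient.mk (Pi.single (M.src x) 1) :
        (M.Vertex → ZMod 2) ⧸ LinearMap.range M.edgeBoundary))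
        (fun x => ?_) (fun x => by simp only [M.src_rot]) a b
      · rw [Submodule.Quotient.eq, ZModModule.sub_eq_add] at this
        exact this
      · rw [Submodule.Quotient.eq, ZModModule.sub_eq_add]
        refine ⟨Pi.single (M.edge (M.opp x)) 1, ?_⟩
        rw [M.edgeBoundary_single, M.tgt_opp]
    have htop : LinearMap.range M.edgeBoundary ⊔
        Submodule.span (ZMod 2) {(Pi.single (M.src a₀) 1 : M.Vertex → ZMod 2)} = ⊤ := by
      rw [eq_top_iff, ← (Pi.basisFun (ZMod 2) M.Vertex).span_eq, Submodule.span_le]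
      rintro _ ⟨u, rfl⟩
      rw [Pi.basisFun_apply]
      induction u using Quotient.inductionOn with
      | h a =>
        change Pi.single (M.src a) 1 ∈ _
        have h : (Pi.single (M.src a) 1 : M.Vertex → ZMod 2) =
            (Pi.single (M.src a) 1 + Pi.single (M.src a₀) 1) + Pi.single (M.src a₀) 1 := by
          rw [add_assoc, ZModModule.add_self, add_zero]
        rw [h]
        exact Submodule.add_mem_sup (hpair a a₀) (Submodule.mem_span_singleton_self _)
    have h1 := Submodule.finrank_add_le_finrank_add_finrank (LinearMap.range M.edgeBoundary)
      (Submodule.span (ZMod 2) {(Pi.single (M.src a₀) 1 : M.Vertex → ZMod 2)})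
    have h2 : Module.finrank (ZMod 2) (Submodule.span (ZMod 2)
        {(Pi.single (M.src a₀) 1 : M.Vertex → ZMod 2)}) ≤ 1 := by
      simpa using finrank_span_le_card (R := ZMod 2)
        {(Pi.single (M.src a₀) 1 : M.Vertex → ZMod 2)}
    rw [htop, finrank_top, Module.finrank_fintype_fun_eq_card] at h1
    omega
  have hle : LinearMap.range M.faceBoundary ≤ LinearMap.ker M.edgeBoundary := by
    rintro _ ⟨φ, rfl⟩
    exact M.edgeBoundary_faceBoundary φ
  have hE := M.edgeBoundary.finrank_range_add_finrank_ker
  have hF := M.faceBoundary.finrank_range_add_finrank_ker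
  rw [Module.finrank_fintype_fun_eq_card] at hE hF
  have heuler : Fintype.card M.Vertex + Fintype.card M.Face = Fintype.card M.Edge + 2 := by
    rw [← Nat.card_eq_fintype_card, ← Nat.card_eq_fintype_card, ← Nat.card_eq_fintype_card]
    exact M.euler
  exact (Submodule.eq_of_le_of_finrank_le hle (by omega)).ge

end Homology

/-- The two ends of an arc of a simple directed cycle are used by no other arc of the cycle. -/
theorem IsSimpleDirectedCycle.edge_injective {M : PlaneMap D} {n : ℕ} {c : Fin (n + 1) → D}
    (hc : M.IsSimpleDirectedCycle c) : Function.Injective fun k => M.edge (c k) := by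
  intro j k h
  rcases M.edge_eq_iff.1 h with h | h
  · exact hc.simple (congrArg M.src h)
  · have hs : M.src (c k) = M.src (c (j + 1)) := by rw [← hc.chain j, tgt, h]
    rw [hc.simple hs] at h
    exact (hc.not_opp j h.symm).elim

/-- The arcs of a cycle and their opposites. -/
def cycleArcs (M : PlaneMap D) {n : ℕ} (c : Fin (n + 1) → D) : Set D :=
  Set.range c ∪ M.reverse (Set.range c)

/-- Half of the Jordan curve theorem: the arcs of a simple directed cycle and their opposites form
the frontier of a union of faces, which can be chosen to avoid a given face. -/
theorem IsSimpleDirectedCycle.exists_faceClosed {M : PlaneMap D} {n : ℕ} {c : Fin (n + 1) → D}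
    (hc : M.IsSimpleDirectedCycle c) (a₀ : D) :
    ∃ S, M.FaceClosed S ∧ a₀ ∉ S ∧ M.frontier S = M.cycleArcs c := by
  classical
  have := Fintype.ofFinite D
  have hcyc : (∑ k, Pi.single (M.edge (c k)) 1 : M.Edge → ZMod 2) ∈
      LinearMap.ker M.edgeBoundary := by
    rw [LinearMap.mem_ker, map_sum]
    simp only [edgeBoundary_single, hc.chain, Finset.sum_add_distrib]
    have h := Equiv.sum_comp (Equiv.addRight (1 : Fin (n + 1)))
      (fun k => (Pi.single (M.src (c k)) 1 : M.Vertex → ZMod 2))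
    simp only [Equiv.coe_addRight] at h
    rw [h]
    exact ZModModule.add_self _
  obtain ⟨φ, hφ⟩ := M.ker_edgeBoundary_le hcyc
  refine ⟨{a | φ (M.face a) ≠ φ (M.face a₀)}, fun a => ?_, fun h => h rfl, ?_⟩
  · simp only [Set.mem_ofPred_eq, M.face_rot]
  · ext a
    have h1 : φ (M.face a) + φ (M.face (M.opp a)) =
        if ∃ k, M.edge (c k) = M.edge a then 1 else 0 := by
      rw [← M.faceBoundary_apply, hφ, Finset.sum_apply]
      simp only [Pi.single_apply]
      split_ifs with h
      · obtain ⟨k, hk⟩ := h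
        rw [Finset.sum_eq_single k]
        · simp [hk]
        · intro j _ hj
          rw [if_neg]
          rw [← hk]
          exact fun h => hj (hc.edge_injective h.symm)
        · simp
      · exact Finset.sum_eq_zero fun k _ => if_neg fun hk => h ⟨k, hk.symm⟩
    have h2 : a ∈ M.cycleArcs c ↔ ∃ k, M.edge (c k) = M.edge a := by
      simp only [cycleArcs, reverse, Set.mem_union, Set.mem_range, Set.mem_ofPred_eq,
        ← exists_or, M.edge_eq_iff]
      refine exists_congr fun k => or_congr Iff.rfl ?_
      rw [← M.opp.injective.eq_iff, M.opp_opp]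
    have h3 : ∀ x y z : ZMod 2, ¬ (x ≠ z ↔ y ≠ z) ↔ x + y = 1 := by decide
    have h4 : a ∈ M.frontier {a | φ (M.face a) ≠ φ (M.face a₀)} ↔
        φ (M.face a) + φ (M.face (M.opp a)) = 1 := h3 _ _ _
    rw [h2, h4, h1]
    split_ifs with h <;> simp [h]

end PlaneMap

/-! ### Clockwise positions around a vertex -/

namespace PlaneMap

variable {D : Type*} [Finite D]

/-- The number of clockwise turns from the arc `a` to the arc `b`, for arcs with the same initial
vertex (and the junk value 0 otherwise). -/
noncomputable def cwDist (M : PlaneMap D) (a b : D) : ℕ := sInf {n | (M.rot ^ n) a = b}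

theorem exists_rot_pow (M : PlaneMap D) {a b : D} (h : M.src a = M.src b) :
    ∃ n : ℕ, (M.rot ^ n) a = b := by
  obtain ⟨n, -, hn⟩ := (M.src_eq_src_iff.1 h).exists_pow_eq'
  exact ⟨n, hn⟩

theorem rot_pow_cwDist (M : PlaneMap D) {a b : D} (h : M.src a = M.src b) :
    (M.rot ^ M.cwDist a b) a = b :=
  Nat.sInf_mem (s := {n | (M.rot ^ n) a = b}) (M.exists_rot_pow h)

theorem cwDist_le (M : PlaneMap D) {a b : D} {n : ℕ} (h : (M.rot ^ n) a = b) :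
    M.cwDist a b ≤ n :=
  Nat.sInf_le h

theorem cwDist_self (M : PlaneMap D) (a : D) : M.cwDist a a = 0 :=
  Nat.le_zero.1 (M.cwDist_le rfl)

theorem cwDist_inj (M : PlaneMap D) {r a b : D} (ha : M.src r = M.src a) (hb : M.src r = M.src b) :
    M.cwDist r a = M.cwDist r b ↔ a = b := by
  refine ⟨fun h => ?_, fun h => by rw [h]⟩
  rw [← M.rot_pow_cwDist ha, h, M.rot_pow_cwDist hb]

theorem eq_of_cwDist_eq_zero (M : PlaneMap D) {a b : D} (h : M.src a = M.src b)
    (h0 : M.cwDist a b = 0) : a = b := by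
  have h' := M.rot_pow_cwDist h
  rwa [h0, pow_zero, Equiv.Perm.one_apply] at h'

/-- The degree of the initial vertex of an arc. -/
noncomputable def srcDegree (M : PlaneMap D) (a : D) : ℕ := Function.minimalPeriod M.rot a

theorem rot_pow_srcDegree (M : PlaneMap D) (a : D) : (M.rot ^ M.srcDegree a) a = a := by
  rw [← Equiv.Perm.iterate_eq_pow]
  exact Function.iterate_minimalPeriod

theorem srcDegree_pos (M : PlaneMap D) (a : D) : 0 < M.srcDegree a :=
  Function.minimalPeriod_pos_of_mem_periodicPts
    (M.rot.injective.mem_periodicPts a)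

theorem srcDegree_eq (M : PlaneMap D) {a b : D} (h : M.src a = M.src b) :
    M.srcDegree b = M.srcDegree a := by
  obtain ⟨n, rfl⟩ := M.exists_rot_pow h
  rw [← Equiv.Perm.iterate_eq_pow]
  exact Function.minimalPeriod_apply_iterate (M.rot.injective.mem_periodicPts a) n

theorem rot_pow_mod (M : PlaneMap D) (a : D) (n : ℕ) :
    (M.rot ^ (n % M.srcDegree a)) a = (M.rot ^ n) a := by
  simp only [← Equiv.Perm.iterate_eq_pow]
  exact Function.iterate_mod_minimalPeriod_eq

theorem cwDist_lt (M : PlaneMap D) {a b : D} (h : M.src a = M.src b) :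
    M.cwDist a b < M.srcDegree a := by
  refine lt_of_le_of_lt (M.cwDist_le ?_)
    (Nat.mod_lt (M.cwDist a b) (M.srcDegree_pos a))
  rw [M.rot_pow_mod, M.rot_pow_cwDist h]

theorem cwDist_eq (M : PlaneMap D) {a b : D} {n : ℕ} (h : (M.rot ^ n) a = b)
    (hn : n < M.srcDegree a) : M.cwDist a b = n := by
  have hab : M.src a = M.src b := by rw [← h, src_rot_pow]
  have h' := (M.rot_pow_cwDist hab).trans h.symm
  simp only [← Equiv.Perm.iterate_eq_pow] at h'
  exact (Function.iterate_eq_iterate_iff_of_lt_minimalPeriod (M.cwDist_lt hab) hn).1 h'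

/-- Change of the arc from which clockwise positions are measured. -/
theorem cwDist_change (M : PlaneMap D) {r a b : D} (ha : M.src r = M.src a)
    (hb : M.src r = M.src b) :
    M.cwDist a b = if M.cwDist r a ≤ M.cwDist r b then M.cwDist r b - M.cwDist r a
      else M.cwDist r b + M.srcDegree r - M.cwDist r a := by
  have hra := M.cwDist_lt ha
  have hrb := M.cwDist_lt hb
  have hd := M.srcDegree_eq ha
  have hpow : ∀ n, (M.rot ^ n) a = (M.rot ^ (n + M.cwDist r a)) r := by
    intro n
    rw [pow_add, Equiv.Perm.mul_apply, M.rot_pow_cwDist ha]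
  split_ifs with h
  · refine M.cwDist_eq ?_ (by omega)
    rw [hpow, Nat.sub_add_cancel h, M.rot_pow_cwDist hb]
  · refine M.cwDist_eq ?_ (by omega)
    rw [hpow, Nat.sub_add_cancel (by omega), pow_add, Equiv.Perm.mul_apply, M.rot_pow_srcDegree,
      M.rot_pow_cwDist hb]

theorem mem_cwInterval_iff_cwDist_le (M : PlaneMap D) {a b x : D} (hb : M.src a = M.src b)
    (hx : M.src a = M.src x) : x ∈ M.cwInterval a b ↔ M.cwDist a x ≤ M.cwDist a b := by
  constructor
  · rintro ⟨m, n, hmn, hm, hn, hfirst⟩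
    refine (M.cwDist_le hm).trans (hmn.trans ?_)
    by_contra! hlt
    exact hfirst _ hlt (M.rot_pow_cwDist hb)
  · intro h
    refine ⟨_, _, h, M.rot_pow_cwDist hx, M.rot_pow_cwDist hb, fun k hk hkb => ?_⟩
    have := M.cwDist_le hkb
    omega

/-- Clockwise intervals in terms of the positions measured from any arc `r` at the vertex. -/
theorem mem_cwInterval_iff (M : PlaneMap D) {r a b x : D} (ha : M.src r = M.src a)
    (hb : M.src r = M.src b) (hx : M.src r = M.src x) :
    x ∈ M.cwInterval a b ↔
      (M.cwDist r a ≤ M.cwDist r x ∧ M.cwDist r x ≤ M.cwDist r b) ∨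
      (M.cwDist r b < M.cwDist r a ∧
        (M.cwDist r a ≤ M.cwDist r x ∨ M.cwDist r x ≤ M.cwDist r b)) := by
  rw [M.mem_cwInterval_iff_cwDist_le (ha.symm.trans hb) (ha.symm.trans hx),
    M.cwDist_change ha hx, M.cwDist_change ha hb]
  have h1 := M.cwDist_lt ha
  have h2 := M.cwDist_lt hb
  have h3 := M.cwDist_lt hx
  split_ifs <;> omega

/-! ### The two sides of a simple cycle -/

theorem FaceClosed.rot_mem_iff {M : PlaneMap D} {S : Set D} (hS : M.FaceClosed S) {a : D}
    (ha : a ∉ M.frontier S) : M.rot a ∈ S ↔ a ∈ S :=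
  (hS a).symm.trans (not_not.1 ha).symm

theorem FaceClosed.rot_pow_mem_iff {M : PlaneMap D} {S : Set D} (hS : M.FaceClosed S) {a : D}
    {m n : ℕ} (hmn : m ≤ n) (h : ∀ k, m ≤ k → k < n → (M.rot ^ k) a ∉ M.frontier S) :
    (M.rot ^ n) a ∈ S ↔ (M.rot ^ m) a ∈ S := by
  induction n, hmn using Nat.le_induction with
  | base => rfl
  | succ n hmn ih =>
    rw [pow_succ', Equiv.Perm.mul_apply, hS.rot_mem_iff (h n hmn n.lt_succ_self),
      ih fun k h1 h2 => h k h1 (h2.trans n.lt_succ_self)]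

/-- Around a vertex disjoint from the frontier, all sectors are on the same side. -/
theorem FaceClosed.mem_iff_of_src_eq {M : PlaneMap D} {S : Set D} (hS : M.FaceClosed S) {a b : D}
    (hab : M.src a = M.src b) (h : ∀ x, M.src x = M.src a → x ∉ M.frontier S) :
    b ∈ S ↔ a ∈ S := by
  obtain ⟨n, rfl⟩ := M.exists_rot_pow hab
  exact hS.rot_pow_mem_iff (Nat.zero_le n) fun k _ _ => h _ (M.src_rot_pow k a)

open Fin.CommRing in
/-- Induction along the indices of a cycle. -/
theorem forall_of_cyclic {n : ℕ} {p : Fin (n + 1) → Prop} (h : ∀ k, p k → p (k + 1))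
    {k : Fin (n + 1)} (hk : p k) (j : Fin (n + 1)) : p j := by
  have hm : ∀ m : ℕ, p (k + (m : Fin (n + 1))) := by
    intro m
    induction m with
    | zero => simpa using hk
    | succ m ih => rw [Nat.cast_succ, ← add_assoc]; exact h _ ih
  have := hm (j - k).val
  rwa [Fin.cast_val_eq_self, add_sub_cancel] at this

theorem iff_of_cyclic {n : ℕ} {p : Fin (n + 1) → Prop} (h : ∀ k, p k ↔ p (k + 1))
    (j k : Fin (n + 1)) : p j ↔ p k :=
  ⟨fun hj => forall_of_cyclic (fun k => (h k).1) hj k,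
    fun hk => forall_of_cyclic (fun k => (h k).1) hk j⟩

namespace IsSimpleDirectedCycle

variable {M : PlaneMap D} {n : ℕ} {c : Fin (n + 1) → D} {S T : Set D}

/-- At a vertex of the cycle, only two arcs belong to edges of the cycle. -/
theorem eq_or_eq_of_mem_cycleArcs (hc : M.IsSimpleDirectedCycle c) {k : Fin (n + 1)} {x : D}
    (hsrc : M.src x = M.src (c (k + 1))) (hx : x ∈ M.cycleArcs c) :
    x = c (k + 1) ∨ x = M.opp (c k) := by
  rcases hx with ⟨j, rfl⟩ | ⟨j, hj⟩
  · exact Or.inl (congrArg c (hc.simple hsrc))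
  · right
    have h : M.src (c (j + 1)) = M.src (c (k + 1)) := by
      rw [← hc.chain j, hj, M.tgt_opp, hsrc]
    rw [← add_right_cancel (hc.simple h), hj, M.opp_opp]

theorem src_opp (hc : M.IsSimpleDirectedCycle c) (k : Fin (n + 1)) :
    M.src (c (k + 1)) = M.src (M.opp (c k)) := (hc.chain k).symm

theorem cwDist_pos (hc : M.IsSimpleDirectedCycle c) (k : Fin (n + 1)) :
    0 < M.cwDist (c (k + 1)) (M.opp (c k)) := by
  exact Nat.pos_of_ne_zero fun h => hc.not_opp k (M.eq_of_cwDist_eq_zero (hc.src_opp k) h)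

theorem rot_pow_notMem_frontier (hc : M.IsSimpleDirectedCycle c)
    (hT : M.frontier T ⊆ M.cycleArcs c) {k : Fin (n + 1)} {m : ℕ} (hm : 0 < m)
    (hme : m ≠ M.cwDist (c (k + 1)) (M.opp (c k))) (hmd : m < M.srcDegree (c (k + 1))) :
    (M.rot ^ m) (c (k + 1)) ∉ M.frontier T := by
  intro h
  have hd := M.cwDist_eq rfl hmd
  rcases hc.eq_or_eq_of_mem_cycleArcs (M.src_rot_pow _ _) (hT h) with h | h
  · rw [h, M.cwDist_self] at hd
    omega
  · rw [h] at hd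
    exact hme hd.symm

/-- The sectors clockwise from the outgoing to the incoming edge of the cycle are on the side of the
face on the right of the outgoing arc. -/
theorem mem_iff_right (hc : M.IsSimpleDirectedCycle c) (hT : M.FaceClosed T)
    (hTc : M.frontier T ⊆ M.cycleArcs c) {k : Fin (n + 1)} {x : D}
    (hx : M.src (c (k + 1)) = M.src x) (h0 : 0 < M.cwDist (c (k + 1)) x)
    (he : M.cwDist (c (k + 1)) x ≤ M.cwDist (c (k + 1)) (M.opp (c k))) :
    x ∈ T ↔ M.opp (c (k + 1)) ∈ T := by
  have hlt := M.cwDist_lt hx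
  have h := hT.rot_pow_mem_iff (a := c (k + 1)) (m := 1) h0 fun j hj1 hj2 =>
    hc.rot_pow_notMem_frontier hTc (by omega) (by omega) (by omega)
  rw [M.rot_pow_cwDist hx, pow_one] at h
  exact h.trans (hT _).symm

/-- The other sectors are on the side of the face on the left of the outgoing arc. -/
theorem mem_iff_left (hc : M.IsSimpleDirectedCycle c) (hT : M.FaceClosed T)
    (hTc : M.frontier T ⊆ M.cycleArcs c) {k : Fin (n + 1)} {x : D}
    (hx : M.src (c (k + 1)) = M.src x)
    (he : M.cwDist (c (k + 1)) (M.opp (c k)) < M.cwDist (c (k + 1)) x) :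
    x ∈ T ↔ c (k + 1) ∈ T := by
  have h := hT.rot_pow_mem_iff (a := c (k + 1)) (M.cwDist_lt hx).le fun j hj1 hj2 =>
    hc.rot_pow_notMem_frontier hTc (by omega) (by omega) hj2
  rw [M.rot_pow_cwDist hx, M.rot_pow_srcDegree] at h
  exact h.symm

theorem opp_mem_iff_succ (hc : M.IsSimpleDirectedCycle c) (hT : M.FaceClosed T)
    (hTc : M.frontier T ⊆ M.cycleArcs c) (k : Fin (n + 1)) :
    M.opp (c k) ∈ T ↔ M.opp (c (k + 1)) ∈ T :=
  hc.mem_iff_right hT hTc (hc.src_opp k) (hc.cwDist_pos k) le_rfl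

theorem mem_iff_succ (hc : M.IsSimpleDirectedCycle c) (hT : M.FaceClosed T)
    (hTc : M.frontier T ⊆ M.cycleArcs c) (k : Fin (n + 1)) :
    c k ∈ T ↔ c (k + 1) ∈ T := by
  have h1 : c k ∈ T ↔ M.rot (M.opp (c k)) ∈ T := by
    rw [← hT, M.opp_opp]
  have hlt := M.cwDist_lt (hc.src_opp k)
  have h := hT.rot_pow_mem_iff (a := c (k + 1)) (Nat.succ_le_of_lt hlt) fun j hj1 hj2 =>
    hc.rot_pow_notMem_frontier hTc (by omega) (by omega) hj2
  rw [M.rot_pow_srcDegree, Nat.succ_eq_add_one, pow_succ', Equiv.Perm.mul_apply,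
    M.rot_pow_cwDist (hc.src_opp k)] at h
  exact h1.trans h.symm

/-- The other half of the Jordan curve theorem: each side of a simple cycle is connected. A union of
faces `T` in the complement of `S` whose frontier lies on the cycle crosses either no edge or every
edge of the cycle; then `T`, respectively the symmetric difference of `S` and `T`, has no
frontier. -/
theorem eq_empty_of_frontier_subset (hc : M.IsSimpleDirectedCycle c) (hS : M.FaceClosed S)
    (hSc : M.frontier S = M.cycleArcs c) (hT : M.FaceClosed T)
    (hTc : M.frontier T ⊆ M.cycleArcs c) (hST : Disjoint S T) {a₀ : D} (hS₀ : a₀ ∉ S)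
    (hT₀ : a₀ ∉ T) : T = ∅ := by
  have hcross : ∀ j k, c j ∈ M.frontier T ↔ c k ∈ M.frontier T := iff_of_cyclic fun k =>
    not_congr (iff_congr (hc.mem_iff_succ hT hTc k) (hc.opp_mem_iff_succ hT hTc k))
  have hopp : ∀ {U : Set D} a, M.opp a ∈ M.frontier U ↔ a ∈ M.frontier U := by
    intro U a
    refine not_congr ?_
    rw [M.opp_opp]
    exact iff_comm
  by_cases h : c 0 ∈ M.frontier T
  · have hTS : M.frontier T = M.frontier S := by
      refine Set.Subset.antisymm (hSc ▸ hTc) ?_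
      rw [hSc]
      rintro a (⟨k, rfl⟩ | ⟨k, hk⟩)
      · exact (hcross 0 k).1 h
      · rw [← hopp, ← hk]
        exact (hcross 0 k).1 h
    have hU : M.FaceClosed {a | ¬ (a ∈ S ↔ a ∈ T)} := fun a =>
      not_congr (iff_congr (hS a) (hT a))
    have hUf : ∀ a, a ∉ M.frontier {a | ¬ (a ∈ S ↔ a ∈ T)} := by
      intro a ha
      have h1 : a ∈ M.frontier T ↔ a ∈ M.frontier S := by rw [hTS]
      simp only [frontier, Set.mem_ofPred_eq] at h1 ha
      tauto
    have hU₀ : ∀ a, a ∈ S ↔ a ∈ T := fun a =>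
      not_not.1 fun ha => (hU.mem_iff_mem hUf a a₀).1 ha (iff_of_false hS₀ hT₀)
    ext a
    refine iff_of_false (fun ha => ?_) id
    exact Set.disjoint_left.1 hST ((hU₀ a).2 ha) ha
  · have hTf : ∀ a, a ∉ M.frontier T := by
      intro a ha
      rcases hTc ha with ⟨k, rfl⟩ | ⟨k, hk⟩
      · exact h ((hcross k 0).1 ha)
      · rw [← hopp, ← hk] at ha
        exact h ((hcross k 0).1 ha)
    ext a
    exact iff_of_false (fun ha => hT₀ ((hT.mem_iff_mem hTf a a₀).1 ha)) id

/-- If a cycle `c'` runs inside the closed region bounded by a simple cycle `c`, then `c'` encloses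
only faces that `c` encloses. Interiors are taken with respect to a face `a₀` outside. -/
theorem subset_of_cycle_in_region {n' : ℕ} {c' : Fin (n' + 1) → D} {S' : Set D}
    (hc : M.IsSimpleDirectedCycle c) (hS : M.FaceClosed S) (hSc : M.frontier S = M.cycleArcs c)
    (hS' : M.FaceClosed S') (hSc' : M.frontier S' = M.cycleArcs c')
    (hin : ∀ k, c' k ∈ S ∨ M.opp (c' k) ∈ S) {a₀ : D} (h₀ : a₀ ∉ S) (h₀' : a₀ ∉ S') :
    S' ⊆ S := by
  have hT : M.FaceClosed (S' \ S) := fun a =>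
    and_congr (hS' a) (not_congr (hS a))
  have hTc : M.frontier (S' \ S) ⊆ M.cycleArcs c := by
    intro a ha
    rw [← hSc]
    by_contra haS
    have ha' : a ∉ M.frontier S' ∨ a ∈ S ∨ M.opp a ∈ S := by
      rw [or_iff_not_imp_left, not_not, hSc']
      rintro (⟨k, rfl⟩ | ⟨k, hk⟩)
      · exact hin k
      · have h := hin k
        rw [hk, M.opp_opp] at h
        exact h.symm
    simp only [frontier, Set.mem_ofPred_eq, Set.mem_sdiff] at ha haS ha'
    tauto
  have h := hc.eq_empty_of_frontier_subset hS hSc hT hTc Set.disjoint_sdiff_right h₀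
    (fun h => h₀' h.1)
  rwa [Set.sdiff_eq_empty] at h

end IsSimpleDirectedCycle

end PlaneMap

/-! ### Directed walks and cycles -/

namespace PlaneMap

variable {D : Type*} [Finite D]

theorem IsAcyclic.mono {M : PlaneMap D} {A B : Set D} (hB : M.IsAcyclic B) (h : A ⊆ B) :
    M.IsAcyclic A := fun n c hc => hB n c fun k => h (hc k)

/-- A walk that never gets stuck eventually runs through a simple cycle. -/
theorem exists_cycle (M : PlaneMap D) {A : Set D} (hA : ∀ a ∈ A, M.opp a ∉ A)
    {X : Set M.Vertex} (hX : X.Nonempty) (hout : ∀ u ∈ X, ∃ a ∈ A, M.src a = u ∧ M.tgt a ∈ X) :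
    ∃ (n : ℕ) (c : Fin (n + 1) → D), (∀ k, c k ∈ A) ∧ M.IsSimpleDirectedCycle c := by
  choose arc harc hsrc htgt using fun u : X => hout u.1 u.2
  let next : X → X := fun u => ⟨M.tgt (arc u), htgt u⟩
  obtain ⟨x₀, hx₀⟩ := hX
  obtain ⟨y, hy⟩ : ∃ y, y ∈ Function.periodicPts next := by
    obtain ⟨m, n, hmn, h⟩ :=
      Finite.exists_ne_map_eq_of_infinite fun n : ℕ => next^[n] ⟨x₀, hx₀⟩
    wlog hlt : m < n generalizing m n
    · exact this n m hmn.symm h.symm (by omega)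
    refine ⟨next^[m] ⟨x₀, hx₀⟩, n - m, by omega, ?_⟩
    change next^[n - m] (next^[m] ⟨x₀, hx₀⟩) = _
    rw [← Function.iterate_add_apply, Nat.sub_add_cancel hlt.le]
    exact h.symm
  obtain ⟨n, hn⟩ : ∃ n, Function.minimalPeriod next y = n + 1 :=
    Nat.exists_eq_succ_of_ne_zero (Function.minimalPeriod_pos_of_mem_periodicPts hy).ne'
  have hmod : ∀ m, next^[m % (n + 1)] y = next^[m] y := by
    intro m
    rw [← hn, Function.iterate_mod_minimalPeriod_eq]
  refine ⟨n, fun k => arc (next^[k] y), fun k => harc _, ?_, ?_, ?_⟩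
  · intro k
    have h : next^[(k + 1 : Fin (n + 1))] y = next (next^[k] y) := by
      rw [Fin.val_add, Fin.val_one', Nat.add_mod_mod, hmod, Function.iterate_succ_apply']
    rw [hsrc, h]
  · intro j k h
    simp only [hsrc] at h
    exact Fin.ext <| (Function.iterate_eq_iterate_iff_of_lt_minimalPeriod
      (by omega) (by omega)).1 (Subtype.ext h)
  · intro k h
    exact hA _ (harc (next^[k] y)) (h ▸ harc _)

/-- There is an arc of `A` from the first vertex to the second. -/
def Step (M : PlaneMap D) (A : Set D) (x y : M.Vertex) : Prop := ∃ a ∈ A, M.src a = x ∧ M.tgt a = y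

theorem IsDirectedWalk.reflTransGen {M : PlaneMap D} {A : Set D} {w : M.Vertex} {p : List D}
    {u x : M.Vertex} (hp : M.IsDirectedWalk A u w p) (hx : x ∈ M.support u p) :
    Relation.ReflTransGen (M.Step A) u x := by
  induction p generalizing u with
  | nil =>
    rw [support, List.map_nil, List.mem_singleton] at hx
    rw [hx]
  | cons a p ih =>
    obtain ⟨ha, hs, hp⟩ := hp
    rw [support, List.map_cons, List.mem_cons] at hx
    rcases hx with rfl | hx
    · exact .refl
    · exact .head ⟨a, ha, hs, rfl⟩ (ih hp hx)

theorem IsDirectedWalk.exists_suffix {M : PlaneMap D} {A : Set D} {w : M.Vertex} {p : List D}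
    {u x : M.Vertex} (hp : M.IsDirectedWalk A u w p) (hx : x ∈ M.support u p) :
    ∃ q, M.IsDirectedWalk A x w q ∧ q.length ≤ p.length := by
  induction p generalizing u with
  | nil =>
    rw [support, List.map_nil, List.mem_singleton] at hx
    exact ⟨[], hx ▸ hp, le_rfl⟩
  | cons a p ih =>
    rw [support, List.map_cons, List.mem_cons] at hx
    rcases hx with rfl | hx
    · exact ⟨_, hp, le_rfl⟩
    · obtain ⟨q, hq, hl⟩ := ih hp.2.2 hx
      exact ⟨q, hq, hl.trans (Nat.le_succ _)⟩

/-- If vertices have at most one outgoing arc in `A`, and `r` none, then walks to `r` are unique. -/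
theorem IsDirectedWalk.unique {M : PlaneMap D} {A : Set D} {r : M.Vertex}
    (hA : ∀ a ∈ A, ∀ b ∈ A, M.src a = M.src b → a = b) (hr : ∀ a ∈ A, M.src a ≠ r)
    {u : M.Vertex} {p q : List D} (hp : M.IsDirectedWalk A u r p)
    (hq : M.IsDirectedWalk A u r q) : p = q := by
  induction p generalizing u q with
  | nil =>
    cases q with
    | nil => rfl
    | cons b q => exact (hr b hq.1 (hq.2.1.trans hp)).elim
  | cons a p ih =>
    cases q with
    | nil => exact (hr a hp.1 (hp.2.1.trans hq)).elim
    | cons b q =>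
      obtain rfl := hA a hp.1 b hq.1 (hp.2.1.trans hq.2.1.symm)
      rw [ih hp.2.2 hq.2.2]

/-- If walks to `r` are unique, they are paths. -/
theorem IsDirectedWalk.nodup_support {M : PlaneMap D} {A : Set D} {r : M.Vertex}
    (huniq : ∀ u p q, M.IsDirectedWalk A u r p → M.IsDirectedWalk A u r q → p = q)
    {u : M.Vertex} {p : List D} (hp : M.IsDirectedWalk A u r p) : (M.support u p).Nodup := by
  induction p generalizing u with
  | nil => exact List.nodup_singleton u
  | cons a p ih =>
    rw [support, List.map_cons, List.nodup_cons]
    refine ⟨fun hu => ?_, ih hp.2.2⟩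
    obtain ⟨q, hq, hl⟩ := hp.2.2.exists_suffix hu
    rw [huniq _ _ _ hq hp, List.length_cons] at hl
    omega

/-- Two directed walks with the same ends `u ≠ w`, one in `A` and one in `B`, together contain a
simple cycle of `A ∪ M.reverse B`: it is found by going from `u` to `w` on the first one and back on
the second one. -/
theorem not_isAcyclic_of_reflTransGen (M : PlaneMap D) {A B : Set D}
    (hA : ∀ a ∈ A, M.opp a ∉ A) (hB : ∀ a ∈ B, M.opp a ∉ B) (hAB : Disjoint A B) {u w : M.Vertex}
    (huw : u ≠ w) (h1 : Relation.ReflTransGen (M.Step A) u w)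
    (h2 : Relation.ReflTransGen (M.Step B) u w) : ¬ M.IsAcyclic (A ∪ M.reverse B) := by
  have hanti : ∀ a ∈ A ∪ M.reverse B, M.opp a ∉ A ∪ M.reverse B := by
    rintro a (ha | ha) (ha' | ha')
    · exact hA a ha ha'
    · have h : M.opp (M.opp a) ∈ B := ha'
      rw [M.opp_opp] at h
      exact Set.disjoint_left.1 hAB ha h
    · exact Set.disjoint_left.1 hAB ha' ha
    · exact hB _ ha ha'
  obtain ⟨n, c, hcA, hc⟩ := M.exists_cycle hanti
    (X := {x | (Relation.ReflTransGen (M.Step A) u x ∧ Relation.ReflTransGen (M.Step A) x w) ∨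
      (Relation.ReflTransGen (M.Step B) u x ∧ Relation.ReflTransGen (M.Step B) x w)})
    ⟨u, Or.inl ⟨.refl, h1⟩⟩ (by
      have forward : ∀ x, x ≠ w → Relation.ReflTransGen (M.Step A) u x →
          Relation.ReflTransGen (M.Step A) x w → ∃ a ∈ A ∪ M.reverse B, M.src a = x ∧
            Relation.ReflTransGen (M.Step A) u (M.tgt a) ∧
            Relation.ReflTransGen (M.Step A) (M.tgt a) w := by
        intro x hx hux hxw
        rcases hxw.cases_head with h | ⟨_, ⟨a, ha, hs, rfl⟩, h⟩
        · exact (hx h).elim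
        · exact ⟨a, Or.inl ha, hs, hux.tail ⟨a, ha, hs, rfl⟩, h⟩
      have backward : ∀ x, x ≠ u → Relation.ReflTransGen (M.Step B) u x →
          Relation.ReflTransGen (M.Step B) x w → ∃ a ∈ A ∪ M.reverse B, M.src a = x ∧
            Relation.ReflTransGen (M.Step B) u (M.tgt a) ∧
            Relation.ReflTransGen (M.Step B) (M.tgt a) w := by
        intro x hx hux hxw
        rcases hux.cases_tail with h | ⟨_, h, ⟨a, ha, rfl, ht⟩⟩
        · exact (hx h).elim
        · refine ⟨M.opp a, Or.inr ?_, ht, ?_⟩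
          · change M.opp (M.opp a) ∈ B
            rwa [M.opp_opp]
          · rw [M.tgt_opp]
            exact ⟨h, hxw.head ⟨a, ha, rfl, ht⟩⟩
      rintro x (⟨hux, hxw⟩ | ⟨hux, hxw⟩)
      · by_cases hx : x = w
        · obtain ⟨a, ha, hs, h⟩ := backward w huw.symm h2 .refl
          exact ⟨a, ha, hs.trans hx.symm, Or.inr h⟩
        · obtain ⟨a, ha, hs, h⟩ := forward x hx hux hxw
          exact ⟨a, ha, hs, Or.inl h⟩
      · by_cases hx : x = u
        · obtain ⟨a, ha, hs, h⟩ := forward u huw .refl h1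
          exact ⟨a, ha, hs.trans hx.symm, Or.inl h⟩
        · obtain ⟨a, ha, hs, h⟩ := backward x hx hux hxw
          exact ⟨a, ha, hs, Or.inr h⟩)
  exact fun h => h n c hcA hc

end PlaneMap

/-! ### Local structure of a 5c-wood -/

namespace FiveTriangulation.IsFiveCWood

variable {D : Type*} [Finite D] {T : FiveTriangulation D} {W : ZMod 5 → Set D}

theorem src_mem (hW : T.IsFiveCWood W) {i : ZMod 5} {a : D} (ha : a ∈ W i) :
    T.src a ∈ T.innerVertices := hW.outer_src i a ha

theorem eq_of_mem (hW : T.IsFiveCWood W) {i j : ZMod 5} {a : D} (hi : a ∈ W i) (hj : a ∈ W j) :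
    i = j := by
  by_contra h
  exact Set.disjoint_left.1 (hW.disjoint i j h) hi hj

theorem eq_of_src_eq (hW : T.IsFiveCWood W) {i : ZMod 5} {a b : D} (ha : a ∈ W i) (hb : b ∈ W i)
    (h : T.src a = T.src b) : a = b :=
  (hW.out_unique _ (hW.src_mem hb) i).unique ⟨ha, h⟩ ⟨hb, rfl⟩

theorem exists_out (hW : T.IsFiveCWood W) {u : T.Vertex} (hu : u ∈ T.innerVertices) :
    ∃ a : ZMod 5 → D, (∀ i, a i ∈ W i) ∧ ∀ i, T.src (a i) = u := by
  choose a ha _ using hW.out_unique u hu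
  exact ⟨a, fun i => (ha i).1, fun i => (ha i).2⟩

/-- The two colors of an edge that is colored in both directions are almost opposite. -/
theorem eq_of_opp_mem (hW : T.IsFiveCWood W) {i j : ZMod 5} {a : D} (ha : a ∈ W i)
    (hopp : T.opp a ∈ W j) : i = j + 2 ∨ i = j + 3 := by
  obtain ⟨b, hb, hbs⟩ := hW.exists_out (hW.src_mem ha)
  have hs : T.src a = T.tgt (T.opp a) := (T.tgt_opp a).symm
  have h := hW.in_between j _ hopp _ (hb _) _ (hb _) ((hbs _).trans hs) ((hbs _).trans hs)
  rw [T.opp_opp] at h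
  have hb3 : b (j + 3) ∈ W (j + 2 + 1) := by
    have h3 : j + 3 = j + 2 + 1 := by ring
    exact h3 ▸ hb _
  rcases hW.out_clockwise (j + 2) i _ (hb _) _ hb3 a ha ((hbs _).trans (hbs _).symm) (hbs _).symm h
    with h | h
  · exact Or.inl (hW.eq_of_mem ha (h ▸ hb _))
  · exact Or.inr (hW.eq_of_mem ha (h ▸ hb _))

theorem opp_notMem (hW : T.IsFiveCWood W) {i : ZMod 5} {a : D} (ha : a ∈ W i) :
    T.opp a ∉ W i := by
  intro h
  have h5 : ∀ i : ZMod 5, ¬ (i = i + 2 ∨ i = i + 3) := by decide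
  exact h5 i (hW.eq_of_opp_mem ha h)

/-- The positions of the outgoing arcs at an inner vertex, clockwise from the one of color `i`. -/
theorem cwDist_lt_cwDist (hW : T.IsFiveCWood W) {a : ZMod 5 → D} (ha : ∀ i, a i ∈ W i)
    (hs : ∀ i j, T.src (a i) = T.src (a j)) (i : ZMod 5) :
    0 < T.cwDist (a i) (a (i + 1)) ∧
    T.cwDist (a i) (a (i + 1)) < T.cwDist (a i) (a (i + 2)) ∧
    T.cwDist (a i) (a (i + 2)) < T.cwDist (a i) (a (i - 2)) ∧
    T.cwDist (a i) (a (i - 2)) < T.cwDist (a i) (a (i - 1)) := by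
  have hcw : ∀ k l, l ≠ k → l ≠ k + 1 → a l ∉ T.cwInterval (a k) (a (k + 1)) := by
    intro k l h1 h2 h
    rcases hW.out_clockwise k l _ (ha _) _ (ha _) _ (ha l) (hs _ _) (hs _ _) h with h | h
    · exact h1 (hW.eq_of_mem (ha l) (h ▸ ha k))
    · exact h2 (hW.eq_of_mem (ha l) (h ▸ ha _))
  simp only [T.mem_cwInterval_iff (r := a i) (hs _ _) (hs _ _) (hs _ _)] at hcw
  -- Relations between colors modulo 5.
  have h5 : ∀ i : ZMod 5, (i ≠ i + 1 ∧ i + 2 ≠ i ∧ i + 2 ≠ i + 1 ∧ i - 2 ≠ i ∧ i - 2 ≠ i + 1 ∧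
      i - 1 ≠ i ∧ i - 1 ≠ i + 1) ∧ (i - 2 ≠ i + 1 + 1 ∧ i - 1 ≠ i + 1 + 1 ∧ i - 1 ≠ i + 2 ∧
      i - 1 ≠ i + 2 + 1) ∧ i + 1 + 1 = i + 2 ∧ i + 2 + 1 = i - 2 := by decide
  obtain ⟨⟨n1, n2, n3, n4, n5, n6, n7⟩, ⟨n8, n9, n10, n11⟩, e2, e3⟩ := h5 i
  have h0 : 0 < T.cwDist (a i) (a (i + 1)) := Nat.pos_of_ne_zero fun h =>
    n1 (hW.eq_of_mem (ha i) (T.eq_of_cwDist_eq_zero (hs _ _) h ▸ ha (i + 1)))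
  have h02 := hcw i (i + 2) n2 n3
  have h03 := hcw i (i - 2) n4 n5
  have h04 := hcw i (i - 1) n6 n7
  have h13 := hcw (i + 1) (i - 2) n5 n8
  have h14 := hcw (i + 1) (i - 1) n7 n9
  have h24 := hcw (i + 2) (i - 1) n10 n11
  rw [e2] at h13 h14
  rw [e3] at h24
  rw [T.cwDist_self] at h02 h03 h04
  omega

end FiveTriangulation.IsFiveCWood

namespace FiveTriangulation

variable {D : Type*} [Finite D] {T : FiveTriangulation D} {W : ZMod 5 → Set D}

/-- The arcs that progress in the direction of color `i`: the arcs of the three colors closest to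
`i`, and the opposites of the arcs of the two other colors. -/
def forwardArcs (T : FiveTriangulation D) (W : ZMod 5 → Set D) (i : ZMod 5) : Set D :=
  W i ∪ W (i - 1) ∪ W (i + 1) ∪ T.reverse (W (i - 2)) ∪ T.reverse (W (i + 2))

theorem opp_mem_of_mem_reverse {A : Set D} {a : D} (h : a ∈ T.reverse A) : T.opp a ∈ A := h

namespace IsFiveCWood

/-- Around an inner vertex, the outgoing forward arcs are between the outgoing arcs of colors
`i - 1` and `i + 1`. -/
theorem forwardArcs_mem_cwInterval (hW : T.IsFiveCWood W) {a : ZMod 5 → D} (ha : ∀ i, a i ∈ W i)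
    (hs : ∀ i j, T.src (a i) = T.src (a j)) {i : ZMod 5} {x : D} (hx : x ∈ T.forwardArcs W i)
    (hxs : T.src (a i) = T.src x) : x ∈ T.cwInterval (a (i - 1)) (a (i + 1)) := by
  have hsx : ∀ k, T.src (a k) = T.src x := fun k => (hs k i).trans hxs
  obtain ⟨h1, h2, h3, h4⟩ := hW.cwDist_lt_cwDist ha hs (i - 1)
  have h0 := T.cwDist_self (a (i - 1))
  have e1 : i - 1 + 1 = i := by ring
  have e2 : i - 1 + 2 = i + 1 := by ring
  rw [e1] at h1 h2
  rw [e2] at h2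
  -- The interval is made of the one from `i - 1` to `i` and the one from `i` to `i + 1`.
  have key : ∀ k l, i - 1 = k ∧ i = l ∨ i = k ∧ i + 1 = l → x ∈ T.cwInterval (a k) (a l) →
      x ∈ T.cwInterval (a (i - 1)) (a (i + 1)) := by
    rintro k l (⟨rfl, rfl⟩ | ⟨rfl, rfl⟩) h <;>
    rw [T.mem_cwInterval_iff (r := a (i - 1)) (hs _ _) (hs _ _) (hsx _)] at h ⊢ <;>
    omega
  rcases hx with (((h | h) | h) | h) | h
  · obtain rfl := hW.eq_of_src_eq (ha i) h hxs
    rw [T.mem_cwInterval_iff (r := a (i - 1)) (hs _ _) (hs _ _) (hsx _)]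
    omega
  · obtain rfl := hW.eq_of_src_eq (ha (i - 1)) h (hsx _)
    rw [T.mem_cwInterval_iff (r := a (i - 1)) (hs _ _) (hs _ _) (hsx _)]
    omega
  · obtain rfl := hW.eq_of_src_eq (ha (i + 1)) h (hsx _)
    rw [T.mem_cwInterval_iff (r := a (i - 1)) (hs _ _) (hs _ _) (hsx _)]
    omega
  all_goals
    have h' := hW.in_between _ _ (opp_mem_of_mem_reverse h) _ (ha _) _ (ha _)
      (by rw [T.tgt_opp]; exact hsx _) (by rw [T.tgt_opp]; exact hsx _)
    rw [T.opp_opp] at h'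
    refine key _ _ ?_ h'
    clear * -
    decide +revert

/-- Around an inner vertex, the incoming forward arcs are between the outgoing arcs of colors
`i + 1` and `i - 1`. -/
theorem opp_forwardArcs_mem_cwInterval (hW : T.IsFiveCWood W) {a : ZMod 5 → D}
    (ha : ∀ i, a i ∈ W i) (hs : ∀ i j, T.src (a i) = T.src (a j)) {i : ZMod 5} {x : D}
    (hx : x ∈ T.forwardArcs W i) (hxs : T.src (a i) = T.tgt x) :
    T.opp x ∈ T.cwInterval (a (i + 1)) (a (i - 1)) := by
  have hsx : ∀ k, T.src (a k) = T.src (T.opp x) := fun k => (hs k i).trans hxs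
  obtain ⟨h1, h2, h3, h4⟩ := hW.cwDist_lt_cwDist ha hs (i + 1)
  have h0 := T.cwDist_self (a (i + 1))
  have e1 : i + 1 + 1 = i + 2 := by ring
  have e2 : i + 1 + 2 = i - 2 := by
    clear * -
    decide +revert
  have e3 : i + 1 - 2 = i - 1 := by ring
  rw [e1] at h1 h2
  rw [e2] at h2 h3
  rw [e3] at h3 h4
  -- The interval is made of three intervals between consecutive colors.
  have key : ∀ k l, i + 1 = k ∧ i + 2 = l ∨ i + 2 = k ∧ i - 2 = l ∨ i - 2 = k ∧ i - 1 = l →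
      T.opp x ∈ T.cwInterval (a k) (a l) → T.opp x ∈ T.cwInterval (a (i + 1)) (a (i - 1)) := by
    rintro k l (⟨rfl, rfl⟩ | ⟨rfl, rfl⟩ | ⟨rfl, rfl⟩) h <;>
    rw [T.mem_cwInterval_iff (r := a (i + 1)) (hs _ _) (hs _ _) (hsx _)] at h ⊢ <;>
    omega
  have hin : ∀ k, x ∈ W k → T.opp x ∈ T.cwInterval (a (k + 2)) (a (k + 3)) := fun k h =>
    hW.in_between _ _ h _ (ha _) _ (ha _) (hsx _) (hsx _)
  rcases hx with (((h | h) | h) | h) | h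
  · exact key _ _ (by clear * -; decide +revert) (hin _ h)
  · exact key _ _ (by clear * -; decide +revert) (hin _ h)
  · exact key _ _ (by clear * -; decide +revert) (hin _ h)
  all_goals
    rw [← hW.eq_of_src_eq (ha _) (opp_mem_of_mem_reverse h) (hsx _),
      T.mem_cwInterval_iff (r := a (i + 1)) (hs _ _) (hs _ _) (hs _ _)]
    omega

/-- No forward arc starts at an outer vertex where another one ends. -/
theorem src_mem_of_cycle (hW : T.IsFiveCWood W) {i : ZMod 5} {n : ℕ} {c : Fin (n + 1) → D}
    (hcW : ∀ k, c k ∈ T.forwardArcs W i) (hc : T.IsSimpleDirectedCycle c) (k : Fin (n + 1)) :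
    T.src (c k) ∈ T.innerVertices := by
  intro l hl
  have h1 : l = i ∨ l = i - 1 ∨ l = i + 1 := by
    have ht : T.tgt (c (k - 1)) = T.v l := by
      rw [hc.chain, sub_add_cancel, hl]
    have hrev : ∀ j, c (k - 1) ∉ T.reverse (W j) := fun j h => hW.src_mem h l ht
    have hfwd : ∀ j, c (k - 1) ∈ W j → l = j := fun j h => (hW.outer_tgt _ _ h _ ht).symm
    rcases hcW (k - 1) with (((h | h) | h) | h) | h
    · exact Or.inl (hfwd _ h)
    · exact Or.inr (Or.inl (hfwd _ h))
    · exact Or.inr (Or.inr (hfwd _ h))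
    · exact (hrev _ h).elim
    · exact (hrev _ h).elim
  have h2 : l = i - 2 ∨ l = i + 2 := by
    have hfwd : ∀ j, c k ∉ W j := fun j h => hW.src_mem h l hl
    have hrev : ∀ j, c k ∈ T.reverse (W j) → l = j := fun j h =>
      (hW.outer_tgt _ _ (opp_mem_of_mem_reverse h) _ ((T.tgt_opp _).trans hl)).symm
    rcases hcW k with (((h | h) | h) | h) | h
    · exact (hfwd _ h).elim
    · exact (hfwd _ h).elim
    · exact (hfwd _ h).elim
    · exact Or.inl (hrev _ h)
    · exact Or.inr (hrev _ h)
  have h5 : ∀ i l : ZMod 5, (l = i ∨ l = i - 1 ∨ l = i + 1) → ¬ (l = i - 2 ∨ l = i + 2) := by decide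
  exact h5 i l h1 h2

end IsFiveCWood

/-! ### Acyclicity -/

theorem outer_mem_iff {S : Set D} (hS : T.FaceClosed S) (j : ZMod 5) :
    T.outer j ∈ S ↔ T.outer 0 ∈ S := by
  have h : ∀ i, T.outer (i + 1) ∈ S ↔ T.outer i ∈ S := by
    intro i
    have h1 := hS (T.opp (T.outer i))
    rw [T.opp_opp] at h1
    rw [h1, ← T.outer_next]
    rfl
  have hn : ∀ n : ℕ, T.outer n ∈ S ↔ T.outer 0 ∈ S := by
    intro n
    induction n with
    | zero => rw [Nat.cast_zero]
    | succ n ih => rw [Nat.cast_succ, h, ih]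
  have := hn j.val
  rwa [ZMod.natCast_zmod_val] at this

theorem src_eq_of_mem_cycleArcs {n : ℕ} {c : Fin (n + 1) → D}
    (hc : T.IsSimpleDirectedCycle c) {a : D} (ha : a ∈ T.cycleArcs c) :
    ∃ k, T.src a = T.src (c (k + 1)) := by
  rcases ha with ⟨k, rfl⟩ | ⟨k, hk⟩
  · exact ⟨k - 1, by rw [sub_add_cancel]⟩
  · exact ⟨k, by rw [← hc.chain, hk, T.tgt_opp]⟩

/-- A region bounded by a cycle of inner vertices, and not containing the outer face, contains no
outer vertex. -/
theorem src_mem_of_mem_region {n : ℕ} {c : Fin (n + 1) → D}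
    (hc : T.IsSimpleDirectedCycle c) (hinner : ∀ k, T.src (c k) ∈ T.innerVertices) {S : Set D}
    (hS : T.FaceClosed S) (hSc : T.frontier S = T.cycleArcs c) (h₀ : T.outer 0 ∉ S) {x : D}
    (hx : x ∈ S) : T.src x ∈ T.innerVertices := by
  intro j hj
  refine h₀ ((outer_mem_iff hS j).1 ((hS.mem_iff_of_src_eq hj fun y hy hyS => ?_).2 hx))
  rw [hSc] at hyS
  obtain ⟨k, hk⟩ := src_eq_of_mem_cycleArcs hc hyS
  exact hinner _ j (hk.symm.trans (hy.trans hj))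

namespace IsFiveCWood

/-- A cycle of forward arcs traps the outgoing arcs of some color `j`: color `i + 1` if its interior
is on its right, color `i - 1` if it is on its left. -/
theorem exists_color_trapped (hW : T.IsFiveCWood W) {i : ZMod 5} {n : ℕ} {c : Fin (n + 1) → D}
    (hcW : ∀ k, c k ∈ T.forwardArcs W i) (hc : T.IsSimpleDirectedCycle c) {S : Set D}
    (hS : T.FaceClosed S) (hSc : T.frontier S = T.cycleArcs c) :
    ∃ j, (j = i + 1 ∨ j = i - 1) ∧
      ∀ x ∈ S, ∀ b ∈ W j, T.src b = T.src x → b ∈ S ∨ T.opp b ∈ S := by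
  have hfront : ∀ k, ¬ (c k ∈ S ↔ T.opp (c k) ∈ S) := by
    intro k
    have h : c k ∈ T.frontier S := by
      rw [hSc]
      exact Or.inl ⟨k, rfl⟩
    exact h
  -- Away from the cycle, all the sectors around the vertex belong to the region.
  have hoff : ∀ x ∈ S, ∀ b, T.src b = T.src x → (∀ k, T.src b ≠ T.src (c (k + 1))) → b ∈ S := by
    intro x hx b hbx hb
    refine (hS.mem_iff_of_src_eq hbx.symm fun y hy hyS => ?_).2 hx
    rw [hSc] at hyS
    obtain ⟨k, hk⟩ := src_eq_of_mem_cycleArcs hc hyS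
    exact hb k ((hbx.trans hy.symm).trans hk)
  -- Positions on the cycle, clockwise from the outgoing arc of the cycle.
  have hpos : ∀ k, ∃ a : ZMod 5 → D, (∀ j, a j ∈ W j) ∧
      (∀ j, T.src (c (k + 1)) = T.src (a j)) ∧
      T.cwDist (c (k + 1)) (a (i + 1)) ≤ T.cwDist (c (k + 1)) (T.opp (c k)) ∧
      (T.cwDist (c (k + 1)) (a (i - 1)) = 0 ∨
        T.cwDist (c (k + 1)) (T.opp (c k)) ≤ T.cwDist (c (k + 1)) (a (i - 1))) := by
    intro k
    obtain ⟨a, ha, hs⟩ := hW.exists_out (hW.src_mem_of_cycle hcW hc (k + 1))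
    have hss : ∀ j l, T.src (a j) = T.src (a l) := fun j l => (hs j).trans (hs l).symm
    have h1 := hW.forwardArcs_mem_cwInterval ha hss (hcW (k + 1)) (hs i)
    have h2 := hW.opp_forwardArcs_mem_cwInterval ha hss (hcW k) ((hs i).trans (hc.chain k).symm)
    rw [T.mem_cwInterval_iff (r := c (k + 1)) (hs _).symm (hs _).symm rfl, T.cwDist_self] at h1
    rw [T.mem_cwInterval_iff (r := c (k + 1)) (hs _).symm (hs _).symm (hc.src_opp k)] at h2
    have h3 := hc.cwDist_pos k
    exact ⟨a, ha, fun j => (hs j).symm, by omega, by omega⟩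
  by_cases h0 : c 0 ∈ S
  · have hl : ∀ k, c k ∈ S := fun k =>
      (PlaneMap.iff_of_cyclic (hc.mem_iff_succ hS hSc.le) 0 k).1 h0
    refine ⟨i - 1, Or.inr rfl, fun x hx b hb hbx => ?_⟩
    by_cases hk : ∃ k, T.src b = T.src (c (k + 1))
    · obtain ⟨k, hk⟩ := hk
      obtain ⟨a, ha, hs, -, h⟩ := hpos k
      obtain rfl := hW.eq_of_src_eq (ha _) hb ((hs _).symm.trans hk.symm)
      rcases h with h | h
      · exact Or.inl (T.eq_of_cwDist_eq_zero (hs _) h ▸ hl _)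
      · rcases h.eq_or_lt with h | h
        · rw [T.cwDist_inj (hc.src_opp k) (hs _)] at h
          right
          rw [← h, T.opp_opp]
          exact hl k
        · exact Or.inl ((hc.mem_iff_left hS hSc.le (hs _) h).2 (hl _))
    · exact Or.inl (hoff x hx b hbx fun k h => hk ⟨k, h⟩)
  · have hr : ∀ k, T.opp (c k) ∈ S := fun k => by
      have h1 := PlaneMap.iff_of_cyclic (hc.mem_iff_succ hS hSc.le) 0 k
      have h2 := hfront k
      tauto
    refine ⟨i + 1, Or.inl rfl, fun x hx b hb hbx => ?_⟩
    by_cases hk : ∃ k, T.src b = T.src (c (k + 1))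
    · obtain ⟨k, hk⟩ := hk
      obtain ⟨a, ha, hs, h, -⟩ := hpos k
      obtain rfl := hW.eq_of_src_eq (ha _) hb ((hs _).symm.trans hk.symm)
      rcases Nat.eq_zero_or_pos (T.cwDist (c (k + 1)) (a (i + 1))) with h' | h'
      · exact Or.inr (T.eq_of_cwDist_eq_zero (hs _) h' ▸ hr _)
      · exact Or.inl ((hc.mem_iff_right hS hSc.le (hs _) h' h).2 (hr _))
    · exact Or.inl (hoff x hx b hbx fun k h => hk ⟨k, h⟩)

/-- A cycle of forward arcs encloses, possibly not strictly, a cycle of a single color. -/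
theorem exists_monochromatic_cycle (hW : T.IsFiveCWood W) {i : ZMod 5} {n : ℕ}
    {c : Fin (n + 1) → D} (hcW : ∀ k, c k ∈ T.forwardArcs W i) (hc : T.IsSimpleDirectedCycle c)
    {S : Set D} (hS : T.FaceClosed S) (hSc : T.frontier S = T.cycleArcs c) (h₀ : T.outer 0 ∉ S) :
    ∃ j, (j = i + 1 ∨ j = i - 1) ∧ ∃ (n' : ℕ) (c' : Fin (n' + 1) → D) (S' : Set D),
      (∀ k, c' k ∈ W j) ∧ T.IsSimpleDirectedCycle c' ∧ T.FaceClosed S' ∧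
      T.frontier S' = T.cycleArcs c' ∧ T.outer 0 ∉ S' ∧ S' ⊆ S := by
  obtain ⟨j, hj, htrap⟩ := hW.exists_color_trapped hcW hc hS hSc
  have hinner := fun {x} => src_mem_of_mem_region (x := x) hc (hW.src_mem_of_cycle hcW hc) hS hSc h₀
  obtain ⟨x₀, hx₀⟩ : S.Nonempty := by
    have h : c 0 ∈ T.frontier S := by
      rw [hSc]
      exact Or.inl ⟨0, rfl⟩
    by_contra! hempty
    subst hempty
    exact h Iff.rfl
  obtain ⟨n', c', hc'W, hc'⟩ := T.exists_cycle (A := W j ∩ {b | b ∈ S ∨ T.opp b ∈ S})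
    (X := {u | ∃ x ∈ S, T.src x = u}) (fun a ha ha' => hW.opp_notMem ha.1 ha'.1)
    ⟨_, x₀, hx₀, rfl⟩ (by
      rintro _ ⟨x, hx, rfl⟩
      obtain ⟨b, ⟨hb, hbx⟩, -⟩ := hW.out_unique _ (hinner hx) j
      have hbS := htrap x hx b hb hbx
      refine ⟨b, ⟨hb, hbS⟩, hbx, ?_⟩
      rcases hbS with h | h
      · refine ⟨T.rot (T.opp b), ?_, T.src_rot _⟩
        rw [← hS, T.opp_opp]
        exact h
      · exact ⟨_, h, rfl⟩)
  obtain ⟨S', hS', h₀', hSc'⟩ := hc'.exists_faceClosed (T.outer 0)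
  exact ⟨j, hj, n', c', S', fun k => (hc'W k).1, hc', hS', hSc', h₀',
    hc.subset_of_cycle_in_region hS hSc hS' hSc' (fun k => (hc'W k).2) h₀ h₀'⟩

/-- A monochromatic cycle would strictly enclose one of the next or previous color, which starts an
infinite descent. -/
theorem not_monochromatic_cycle (hW : T.IsFiveCWood W) {S : Set D} (hS : T.FaceClosed S)
    (h₀ : T.outer 0 ∉ S) {i : ZMod 5} {n : ℕ} {c : Fin (n + 1) → D} (hcW : ∀ k, c k ∈ W i)
    (hc : T.IsSimpleDirectedCycle c) (hSc : T.frontier S = T.cycleArcs c) : False := by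
  induction hN : S.ncard using Nat.strong_induction_on generalizing S i n c with
  | _ N ih =>
    obtain ⟨j, hj, n', c', S', hc'W, hc', hS', hSc', h₀', hsub⟩ :=
      hW.exists_monochromatic_cycle (i := i)
        (fun k => Or.inl (Or.inl (Or.inl (Or.inl (hcW k))))) hc hS hSc h₀
    refine ih S'.ncard ?_ hS' h₀' hc'W hc' hSc' rfl
    rw [← hN]
    refine Set.ncard_lt_ncard (hsub.ssubset_of_ne ?_)
    rintro rfl
    have h : c' 0 ∈ T.cycleArcs c := by
      rw [← hSc, hSc']
      exact Or.inl ⟨0, rfl⟩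
    have h5 : j ≠ i ∧ ¬ (j = i + 2 ∨ j = i + 3) := by
      clear * - hj
      decide +revert
    rcases h with ⟨k, hk⟩ | ⟨k, hk⟩
    · exact h5.1 (hW.eq_of_mem (hc'W 0) (hk ▸ hcW k))
    · exact h5.2 (hW.eq_of_opp_mem (hc'W 0) (hk ▸ hcW k))

theorem isAcyclic_forwardArcs (hW : T.IsFiveCWood W) (i : ZMod 5) :
    T.IsAcyclic (T.forwardArcs W i) := by
  intro n c hcW hc
  obtain ⟨S, hS, h₀, hSc⟩ := hc.exists_faceClosed (T.outer 0)
  obtain ⟨j, -, n', c', S', hc'W, hc', hS', hSc', h₀', -⟩ :=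
    hW.exists_monochromatic_cycle hcW hc hS hSc h₀
  exact hW.not_monochromatic_cycle hS' h₀' hc'W hc' hSc'

/-- For `j ≠ k`, some color `i` makes both the arcs of color `j` and the opposites of those of color
`k` forward arcs. -/
theorem isAcyclic_union_reverse (hW : T.IsFiveCWood W) (j k : ZMod 5) :
    T.IsAcyclic (W j ∪ T.reverse (W k)) := by
  have hfwd : ∀ i l, l = i ∨ l = i - 1 ∨ l = i + 1 → W l ⊆ T.forwardArcs W i := by
    rintro i l (rfl | rfl | rfl) a ha
    · exact Or.inl (Or.inl (Or.inl (Or.inl ha)))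
    · exact Or.inl (Or.inl (Or.inl (Or.inr ha)))
    · exact Or.inl (Or.inl (Or.inr ha))
  have hrev : ∀ i l, l = i - 2 ∨ l = i + 2 → T.reverse (W l) ⊆ T.forwardArcs W i := by
    rintro i l (rfl | rfl) a ha
    · exact Or.inl (Or.inr ha)
    · exact Or.inr ha
  by_cases hjk : j = k
  · subst hjk
    -- An arc against color `j` is never followed by an arc of color `j`, so that the cycle is
    -- directed by color `j` everywhere or nowhere.
    intro n c hcW hc
    have hsucc : ∀ k, c k ∈ T.reverse (W j) → c (k + 1) ∈ T.reverse (W j) := by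
      intro k hk
      refine (hcW (k + 1)).resolve_left fun h => hc.not_opp k ?_
      exact hW.eq_of_src_eq h hk (hc.chain k).symm
    by_cases h : ∃ k, c k ∈ T.reverse (W j)
    · obtain ⟨k, hk⟩ := h
      exact hW.isAcyclic_forwardArcs (j + 2) n c (fun l => hrev _ j
        (Or.inl (by ring)) (PlaneMap.forall_of_cyclic hsucc hk l)) hc
    · exact hW.isAcyclic_forwardArcs j n c (fun l => hfwd j j (Or.inl rfl)
        ((hcW l).resolve_right fun hl => h ⟨l, hl⟩)) hc
  · obtain ⟨i, hi, hi'⟩ : ∃ i, (j = i ∨ j = i - 1 ∨ j = i + 1) ∧ (k = i - 2 ∨ k = i + 2) := by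
      clear * - hjk
      decide +revert
    exact (hW.isAcyclic_forwardArcs i).mono (Set.union_subset (hfwd i j hi) (hrev i k hi'))

/-! ### Trees and paths -/

theorem walk_unique (hW : T.IsFiveCWood W) (i : ZMod 5) (u : T.Vertex) (p q : List D)
    (hp : T.IsDirectedWalk (W i) u (T.v i) p) (hq : T.IsDirectedWalk (W i) u (T.v i) q) : p = q :=
  PlaneMap.IsDirectedWalk.unique (fun _ ha _ hb h => hW.eq_of_src_eq ha hb h)
    (fun _ ha => hW.src_mem ha i) hp hq

theorem tgt_mem (hW : T.IsFiveCWood W) {i : ZMod 5} {a : D} (ha : a ∈ W i) :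
    T.tgt a ∈ T.innerVertices ∪ {T.v i} := by
  by_cases h : ∃ j, T.tgt a = T.v j
  · obtain ⟨j, hj⟩ := h
    rw [← hW.outer_tgt i a ha j hj] at hj
    exact Or.inr hj
  · exact Or.inl fun j hj => h ⟨j, hj⟩

theorem exists_walk (hW : T.IsFiveCWood W) (i : ZMod 5) {u : T.Vertex}
    (hu : u ∈ T.innerVertices) : ∃ p, T.IsDirectedWalk (W i) u (T.v i) p := by
  by_contra hno
  obtain ⟨n, c, hcW, hc⟩ := T.exists_cycle (A := W i)
    (X := {x | x ∈ T.innerVertices ∧ ¬ ∃ p, T.IsDirectedWalk (W i) x (T.v i) p})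
    (fun a ha => hW.opp_notMem ha) ⟨u, hu, hno⟩ (by
      rintro x ⟨hx, hnox⟩
      obtain ⟨a, ⟨ha, rfl⟩, -⟩ := hW.out_unique x hx i
      have hnot : ¬ ∃ p, T.IsDirectedWalk (W i) (T.tgt a) (T.v i) p := by
        rintro ⟨p, hp⟩
        exact hnox ⟨a :: p, ha, rfl, hp⟩
      refine ⟨a, ha, rfl, (hW.tgt_mem ha).resolve_right fun h => hnot ⟨[], h⟩, hnot⟩)
  exact (hW.isAcyclic_union_reverse i i).mono Set.subset_union_left n c hcW hc

theorem isTreeToward (hW : T.IsFiveCWood W) (i : ZMod 5) :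
    T.IsTreeToward (W i) (T.innerVertices ∪ {T.v i}) (T.v i) where
  root_mem := Or.inr rfl
  ends_mem _ ha := ⟨Or.inl (hW.src_mem ha), hW.tgt_mem ha⟩
  acyclic := hW.isAcyclic_union_reverse i i
  walk_to_root u hu := by
    obtain ⟨p, hp⟩ : ∃ p, T.IsDirectedWalk (W i) u (T.v i) p := by
      rcases hu with hu | rfl
      · exact hW.exists_walk i hu
      · exact ⟨[], rfl⟩
    exact ⟨p, hp, fun q hq => hW.walk_unique i u q p hq hp⟩

end IsFiveCWood

end FiveTriangulation

theorem mainTheorem3 {D : Type*} [Finite D] (T : FiveTriangulation D) (W : ZMod 5 → Set D)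
    (hW : T.IsFiveCWood W) :
    (∀ i : ZMod 5, T.IsAcyclic
      (W i ∪ W (i - 1) ∪ W (i + 1) ∪ T.reverse (W (i - 2)) ∪ T.reverse (W (i + 2)))) ∧
    (∀ j k : ZMod 5, T.IsAcyclic (W j ∪ T.reverse (W k))) ∧
    (∀ i : ZMod 5, T.IsTreeToward (W i) (T.innerVertices ∪ {T.v i}) (T.v i)) ∧
    (∀ u ∈ T.innerVertices, ∃ P : ZMod 5 → List D,
      (∀ i, T.IsDirectedPath (W i) u (T.v i) (P i) ∧
        ∀ q, T.IsDirectedPath (W i) u (T.v i) q → q = P i) ∧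
      ∀ i j, i ≠ j → ∀ w, w ∈ T.support u (P i) → w ∈ T.support u (P j) → w = u) := by
  refine ⟨hW.isAcyclic_forwardArcs, hW.isAcyclic_union_reverse, hW.isTreeToward, fun u hu => ?_⟩
  choose P hP using fun i => hW.exists_walk i hu
  refine ⟨P, fun i => ⟨⟨hP i, (hP i).nodup_support (hW.walk_unique i)⟩,
    fun q hq => hW.walk_unique i u q _ hq.1 (hP i)⟩, fun i j hij w hwi hwj => ?_⟩
  by_contra hwu
  exact T.not_isAcyclic_of_reflTransGen (fun _ ha => hW.opp_notMem ha)
    (fun _ ha => hW.opp_notMem ha) (hW.disjoint i j hij) (Ne.symm hwu)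
    ((hP i).reflTransGen hwi) ((hP j).reflTransGen hwj)
    (hW.isAcyclic_union_reverse i j)
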